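/- Let $A,B>0$, $\lambda(s)=\frac{A}{B+s}$ for $s\ge 0$, $\rho^*\ge 0$, $k\in[0,1)$ and $R>0$. For a measurable bounded function $d:[0,\infty)\to\mathbb R$ (measurement error) and $\rho_0\in L^2(0,1)$, consider the closed-loop system $$\partial_t\rho(t,x)+\lambda(W(t))\,\partial_x\rho(t,x)=0,\quad W(t)=\int_0^1\rho(t,x)\,dx,\quad \rho(0,x)=\rho_0(x),\qquad t>0,\ x\in(0,1),$$ with influx $\rho(t,0)\lambda(W(t))=U(t)$ given by the feedback $$U(t)-\rho^*\lambda(\rho^*)=k\big((\rho(t,1)+d(t))\lambda(W(t))-\rho^*\lambda(\rho^*)\big).$$ A function $\rho\in C^0([0,\infty);L^2(0,1))$ with $\rho(0,\cdot)=\rho_0$ and $\rho(t,\cdot)\ge 0$ a.e. in $(0,1)$ for every $t\ge 0$ is called a non-negative weak solution if, for every $s>0$ and every $\varphi\in C^1([0,s]\times[0,1])$ with $\varphi(s,x)=0$ for all $x\in[0,1]$ and $\varphi(t,1)=k\varphi(t,0)$ for all $t\in[0,s]$, $$\int_0^s\!\!\int_0^1\rho\,\big(\partial_t\varphi+\lambda(W(t))\partial_x\varphi\big)\,dx\,dt+\int_0^s\big((1-k)\rho^*\lambda(\rho^*)+k\lambda(W(t))d(t)\big)\varphi(t,0)\,dt+\int_0^1\rho(0,x)\varphi(0,x)\,dx=0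 .$$ Theorem (input-to-state stability of $\rho^*$ in $L^2$). There exist constants $\gamma_1,\gamma_2,\gamma_3>0$, depending only on $A,B,\rho^*,k,R$, such that for every measurable bounded $d$, every $\rho_0\in L^2(0,1)$ with $\rho_0\ge 0$ a.e. and $\|\rho_0-\rho^*\|_{L^2(0,1)}\le R$, and every non-negative weak solution $\rho$ of the closed-loop system (in particular for the unique one, whenever there is exactly one), $$\|\rho(t,\cdot)-\rho^*\|_{L^2(0,1)}\le\gamma_2e^{-\gamma_1t}\|\rho_0-\rho^*\|_{L^2(0,1)}+\gamma_3\sup_{s\in[0,t]}|d(s)|\qquad\text{for all }t\ge 0 .$$ -/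

import Mathlib

open MeasureTheory

namespace NonlocalTransport

/-- Lebesgue measure on the unit interval `(0,1)`. -/
noncomputable abbrev unitMeasure : Measure ℝ := volume.restrict (Set.Ioo (0 : ℝ) 1)

/-- The Hilbert space `L²(0,1)` of real functions (modulo a.e. equality). -/
abbrev L2 : Type := Lp ℝ 2 unitMeasure

/-- The constant function `c` as an element of `L²(0,1)`. -/
noncomputable def const (c : ℝ) : L2 := Lp.const 2 unitMeasure c

/-- The velocity function `λ(s) = A / (B + s)`; it is only evaluated at `s ≥ 0`, with `A, B > 0`. -/
noncomputable def velocity (A B s : ℝ) : ℝ := A / (B + s)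

/-- The total mass `∫₀¹ f(x) dx`. -/
noncomputable def mass (f : L2) : ℝ := ∫ x in Set.Ioo (0 : ℝ) 1, f x

/-- Test functions on `[0,s] × [0,1]` for the closed loop with feedback parameter `k`:
`φ ∈ C¹([0,s] × [0,1])`, `φ(s,·) = 0` and `φ(t,1) = k φ(t,0)` for `t ∈ [0,s]`. -/
structure IsTestFunction (k s : ℝ) (φ : ℝ → ℝ → ℝ) : Prop where
  contDiffOn : ContDiffOn ℝ 1 (fun p : ℝ × ℝ => φ p.1 p.2)
    (Set.Icc (0 : ℝ) s ×ˢ Set.Icc (0 : ℝ) 1)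
  final : ∀ x ∈ Set.Icc (0 : ℝ) 1, φ s x = 0
  boundary : ∀ t ∈ Set.Icc (0 : ℝ) s, φ t 1 = k * φ t 0

/-- `ρ ∈ C⁰([0,∞); L²(0,1))` is a weak solution, with initial datum `ρ₀`, of
`∂ₜρ + λ(W(t)) ∂ₓρ = 0`, `W(t) = ∫₀¹ ρ(t,x) dx`, `ρ(0,·) = ρ₀`, closed by the boundary feedback
`ρ(t,0) λ(W(t)) = U(t)`, `U(t) - ρ* λ(ρ*) = k ((ρ(t,1) + d(t)) λ(W(t)) - ρ* λ(ρ*))`.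
For a test function, `U(t) φ(t,0) - λ(W(t)) ρ(t,1) φ(t,1)` equals
`((1 - k) ρ* λ(ρ*) + k λ(W(t)) d(t)) φ(t,0)`, which is the boundary term of the weak form.
Only the values of `ρ` and `d` at times `t ≥ 0` matter. -/
structure IsWeakSolution (A B ρstar k : ℝ) (d : ℝ → ℝ) (ρ₀ : L2) (ρ : ℝ → L2) : Prop where
  continuousOn : ContinuousOn ρ (Set.Ici 0)
  initial : ρ 0 = ρ₀
  weak : ∀ s : ℝ, 0 < s → ∀ φ : ℝ → ℝ → ℝ, IsTestFunction k s φ →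
    (∫ t in Set.Ioo (0 : ℝ) s, ∫ x in Set.Ioo (0 : ℝ) 1,
        ρ t x * (deriv (fun t' => φ t' x) t
          + velocity A B (mass (ρ t)) * deriv (fun x' => φ t x') x))
      + (∫ t in Set.Ioo (0 : ℝ) s,
        ((1 - k) * ρstar * velocity A B ρstar
          + k * velocity A B (mass (ρ t)) * d t) * φ t 0)
      + (∫ x in Set.Ioo (0 : ℝ) 1, ρ 0 x * φ 0 x) = 0

/-- Admissible measurement errors: Lebesgue measurable and bounded on `[0,∞)`. -/
structure IsDisturbance (d : ℝ → ℝ) : Prop where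
  aemeasurable : AEMeasurable d (volume.restrict (Set.Ici (0 : ℝ)))
  bounded : ∃ D : ℝ, ∀ t : ℝ, 0 ≤ t → |d t| ≤ D

/-- `f ≥ 0` almost everywhere on `(0,1)`. -/
def IsNonneg (f : L2) : Prop := ∀ᵐ x ∂unitMeasure, 0 ≤ f x

end NonlocalTransport

/-! The speed does not depend on x, so everything is transported along the distance travelled, ξ(t)
= ∫₀ᵗ λ(W). A profile `ψ` supported in (0,1), continued by Ψ(y+1) = k Ψ(y) and moved along
characteristics, solves the adjoint problem; testing with it represents ρ(s) through ρ₀ and the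
boundary input (`IsWeakSolution.integral_mul_eq`). Put θ = ρ*/(B+ρ*). Since λ(ρ*) - λ(W) =
λ(W)(W-ρ*)/(B+ρ*), the deviation ρ - ρ* is driven by λ(W)((1-k)θ(W-ρ*) + k d)
(`IsWeakSolution.integral_deviation_mul_eq`). The mass deviation is at most the L² deviation, so the
loop gain is q = (1-k)θ + k < 1, and some c > 0 still has q eᶜ < 1. A small-gain argument with
weight exp(-cξ) gives decay in the distance travelled, plus a multiple of sup |d|
(`IsWeakSolution.norm_deviation_le_travel`). Finally ξ must grow linearly in time. If sup |d| ≤ 1,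
the mass is bounded, hence the speed is bounded below; if sup |d| > 1, the crude bound is absorbed
into the gain on d. -/

namespace NonlocalTransport

open Set intervalIntegral
open scoped ContDiff

/-! ### Weak derivatives in time and L² norms by duality -/

/-- A weak form of `m' = h`, `m 0 = m₀`, tested against functions vanishing at the final time,
determines the final value of `m`. -/
theorem eq_add_integral_of_weak {m h : ℝ → ℝ} {s m₀ : ℝ} (hs : 0 < s) (hm : Continuous m)
    (hh : Integrable h)
    (H : ∀ χ : ℝ → ℝ, ContDiff ℝ 1 χ → χ s = 0 →
      (∫ t in (0 : ℝ)..s, deriv χ t * m t) + (∫ t in (0 : ℝ)..s, h t * χ t) + m₀ * χ 0 = 0) :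
    m s = m₀ + ∫ t in (0 : ℝ)..s, h t := by
  set F : ℝ → ℝ := fun t => ∫ τ in (0 : ℝ)..t, h τ with hF
  have hFc : Continuous F := continuous_primitive (fun a b => hh.intervalIntegrable) 0
  set r : ℝ → ℝ := fun t => m t - F t - m₀ with hr
  have hrc : Continuous r := (hm.sub hFc).sub continuous_const
  -- With this choice χ' = r and χ(s) = 0, so the weak identity becomes ∫ r² = 0.
  set χ : ℝ → ℝ := fun t => ∫ τ in s..t, r τ with hχ
  have hχd : ∀ t, HasDerivAt χ (r t) t := fun t => hrc.integral_hasStrictDerivAt s t |>.hasDerivAt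
  have hder : deriv χ = r := funext fun t => (hχd t).deriv
  have hχ1 : ContDiff ℝ 1 χ := by
    rw [contDiff_one_iff_deriv, hder]
    exact ⟨fun t => (hχd t).differentiableAt, hrc⟩
  have hχs : χ s = 0 := by simp [hχ]
  have hI := H χ hχ1 hχs
  have hparts : ∫ t in (0 : ℝ)..s, h t * χ t = - ∫ t in (0 : ℝ)..s, r t * F t := by
    -- `h` is only integrable, so `F` need not be C¹; integration by parts is the absolutely
    -- continuous version.
    have hFac : AbsolutelyContinuousOnInterval F 0 s :=
      hh.intervalIntegrable.absolutelyContinuousOnInterval_intervalIntegral (by simp)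
    have hχac : AbsolutelyContinuousOnInterval χ 0 s := by
      obtain ⟨K, hK⟩ := hχ1.contDiffOn.exists_lipschitzOnWith (s := uIcc 0 s) one_ne_zero
        (convex_uIcc _ _) isCompact_uIcc
      exact hK.absolutelyContinuousOnInterval
    have h1 := hFac.integral_mul_deriv_eq_deriv_mul hχac
    have h2 : ∫ t in (0 : ℝ)..s, deriv F t * χ t = ∫ t in (0 : ℝ)..s, h t * χ t := by
      refine integral_congr_ae ?_
      have := hh.intervalIntegrable (a := 0) (b := s) |>.ae_hasDerivAt_integral
      filter_upwards [this] with t ht hts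
      rw [(ht (uIoc_subset_uIcc hts) 0 (by simp)).deriv]
    have hF0 : F 0 = 0 := by simp [hF]
    rw [h2, hder, hχs, hF0] at h1
    have h3 : ∫ t in (0 : ℝ)..s, r t * F t = ∫ t in (0 : ℝ)..s, F t * r t := by
      simp_rw [mul_comm]
    linarith
  have hχ0 : χ 0 = - ∫ t in (0 : ℝ)..s, r t := by
    simp only [hχ]; rw [integral_symm]
  have hsq : ∫ t in (0 : ℝ)..s, r t ^ 2 = 0 := by
    have e : ∀ t, r t ^ 2 = r t * m t - r t * F t - m₀ * r t := fun t => by simp only [hr]; ring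
    have i1 : IntervalIntegrable (fun t => r t * m t) volume 0 s :=
      (hrc.mul hm).intervalIntegrable _ _
    have i2 : IntervalIntegrable (fun t => r t * F t) volume 0 s :=
      (hrc.mul hFc).intervalIntegrable _ _
    have i3 : IntervalIntegrable (fun t => m₀ * r t) volume 0 s :=
      (continuous_const.mul hrc).intervalIntegrable _ _
    simp_rw [e]
    rw [integral_sub (i1.sub i2) i3, integral_sub i1 i2, intervalIntegral.integral_const_mul]
    rw [hder, hparts, hχ0] at hI
    linarith
  have hrs : r s = 0 := by
    by_contra hne
    have : 0 < ∫ t in (0 : ℝ)..s, r t ^ 2 :=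
      integral_pos hs (hrc.pow 2).continuousOn (fun t _ => sq_nonneg _)
        ⟨s, right_mem_Icc.2 hs.le, by positivity⟩
    linarith
  simp only [hr] at hrs
  linarith

/-- Norms in `L²(0,1)` can be computed by testing with smooth functions supported in `(0,1)`. -/
theorem norm_le_of_forall_smooth (f : L2) {C : ℝ} (hC : 0 ≤ C)
    (h : ∀ ψ : ℝ → ℝ, ContDiff ℝ ∞ ψ → HasCompactSupport ψ → tsupport ψ ⊆ Ioo 0 1 →
      |∫ x in Ioo (0 : ℝ) 1, f x * ψ x| ≤ C * √(∫ x, ψ x ^ 2)) : ‖f‖ ≤ C := by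
  let S : Submodule ℝ L2 :=
    { carrier := {g | ∃ ψ : ℝ → ℝ, ContDiff ℝ ∞ ψ ∧ HasCompactSupport ψ ∧ tsupport ψ ⊆ Ioo 0 1 ∧
        g =ᵐ[unitMeasure] ψ}
      zero_mem' := ⟨fun _ => 0, contDiff_const, HasCompactSupport.zero, by simp [tsupport],
        Lp.coeFn_zero _ _ _⟩
      add_mem' := by
        rintro a b ⟨ψ, h1, h2, h3, h4⟩ ⟨φ, g1, g2, g3, g4⟩
        exact ⟨ψ + φ, h1.add g1, h2.add g2, (tsupport_add ψ φ).trans (union_subset h3 g3),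
          (Lp.coeFn_add a b).trans (h4.add g4)⟩
      smul_mem' := by
        rintro c a ⟨ψ, h1, h2, h3, h4⟩
        refine ⟨c • ψ, h1.const_smul c, h2.smul_left (f := fun _ => c),
          (tsupport_smul_subset_right (fun _ => c) ψ).trans h3,
          (Lp.coeFn_smul c a).trans (h4.const_smul c)⟩ }
  have hdense : S.topologicalClosure = ⊤ := by
    rw [Submodule.topologicalClosure_eq_top_iff, Submodule.eq_bot_iff]
    intro g hg
    rw [Submodule.mem_orthogonal] at hg
    have hgi : IntegrableOn g (Ioo (0 : ℝ) 1) := (Lp.memLp g).integrable one_le_two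
    have h0 := isOpen_Ioo.ae_eq_zero_of_integral_contDiff_smul_eq_zero (U := Ioo (0 : ℝ) 1)
      (f := g) hgi.locallyIntegrableOn (fun ψ h1 h2 h3 => by
        have hmem : MemLp ψ 2 unitMeasure := (h1.continuous.memLp_of_hasCompactSupport h2).restrict _
        have := hg (hmem.toLp ψ) ⟨ψ, h1, h2, h3, hmem.coeFn_toLp⟩
        rw [L2.inner_def] at this
        rw [← setIntegral_eq_integral_of_forall_compl_eq_zero (s := Ioo (0 : ℝ) 1)]
        · refine Eq.trans ?_ this
          refine integral_congr_ae ?_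
          filter_upwards [hmem.coeFn_toLp] with x hx
          simp [hx, mul_comm]
        · intro x hx
          rw [image_eq_zero_of_notMem_tsupport (fun hh => hx (h3 hh)), zero_smul])
    rw [Lp.eq_zero_iff_ae_eq_zero]
    exact (ae_restrict_iff' measurableSet_Ioo).2 h0
  have hmem : f ∈ S.topologicalClosure := hdense ▸ Submodule.mem_top
  -- The tested inequality is a closed condition on `g`, so by density it holds for g = f.
  have hcl : closure (S : Set L2) ⊆ {g : L2 | |inner ℝ f g| ≤ C * ‖g‖} := by
    refine closure_minimal ?_ (isClosed_le (by fun_prop) (by fun_prop))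
    rintro g ⟨ψ, h1, h2, h3, h4⟩
    have hin : inner ℝ f g = ∫ x in Ioo (0 : ℝ) 1, f x * ψ x := by
      rw [L2.inner_def]
      refine integral_congr_ae ?_
      filter_upwards [h4] with x hx
      simp [hx, mul_comm]
    have hn : ‖g‖ = √(∫ x, ψ x ^ 2) := by
      rw [norm_eq_sqrt_real_inner, L2.inner_def,
        ← setIntegral_eq_integral_of_forall_compl_eq_zero (s := Ioo (0 : ℝ) 1) (f := fun x => ψ x ^ 2)]
      · congr 1
        refine integral_congr_ae ?_
        filter_upwards [h4] with x hx
        simp [hx, sq]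
      · intro x hx
        rw [image_eq_zero_of_notMem_tsupport (fun hh => hx (h3 hh))]; simp
    rw [mem_ofPred_eq, hin, hn]
    exact h ψ h1 h2 h3
  have := hcl hmem
  rw [mem_ofPred_eq, real_inner_self_eq_norm_sq, abs_of_nonneg (by positivity), sq] at this
  by_contra hlt
  push Not at hlt
  rcases (norm_nonneg f).eq_or_lt with h0 | h0
  · linarith
  · exact absurd (le_of_mul_le_mul_right this h0) (not_le.2 hlt)

/-! ### Mass and constants in L²(0,1) -/

theorem coeFn_const (c : ℝ) : const c =ᵐ[unitMeasure] fun _ => c := Lp.coeFn_const _ _ _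

theorem mass_eq_inner (f : L2) : mass f = inner ℝ f (const 1) := by
  rw [mass, L2.inner_def]
  refine integral_congr_ae ?_
  filter_upwards [coeFn_const 1] with x hx
  simp [hx]

theorem mass_const (c : ℝ) : mass (const c) = c := by
  rw [mass, integral_congr_ae (coeFn_const c)]; simp

theorem norm_const_one : ‖const 1‖ = 1 := by
  rw [norm_eq_sqrt_real_inner, ← mass_eq_inner, mass_const, Real.sqrt_one]

theorem continuous_mass : Continuous mass := by
  rw [funext mass_eq_inner]; fun_prop

theorem abs_mass_le (f : L2) : |mass f| ≤ ‖f‖ := by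
  rw [mass_eq_inner]
  simpa [norm_const_one] using abs_real_inner_le_norm f (const 1)

theorem mass_sub (f g : L2) : mass (f - g) = mass f - mass g := by
  simp only [mass_eq_inner, inner_sub_left]

theorem mass_nonneg {f : L2} (hf : IsNonneg f) : 0 ≤ mass f :=
  integral_nonneg_of_ae hf

theorem integrable_mul_continuous (f : L2) {φ : ℝ → ℝ} (hφ : Continuous φ) :
    IntegrableOn (fun x => f x * φ x) (Ioo 0 1) := by
  have h1 : MemLp φ 2 unitMeasure := by
    obtain ⟨C, hC⟩ := isCompact_Icc.exists_bound_of_continuousOn (s := Icc (0 : ℝ) 1)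
      hφ.continuousOn
    exact MemLp.of_bound hφ.aestronglyMeasurable C ((ae_restrict_iff' measurableSet_Ioo).2
      (ae_of_all _ fun x hx => hC x (Ioo_subset_Icc_self hx)))
  exact (Lp.memLp f).integrable_mul h1

theorem integral_sub_const_mul (f : L2) (c : ℝ) {φ : ℝ → ℝ} (hφ : Continuous φ) :
    ∫ x in Ioo (0 : ℝ) 1, (f - const c) x * φ x =
      (∫ x in Ioo (0 : ℝ) 1, f x * φ x) - c * ∫ x in Ioo (0 : ℝ) 1, φ x := by
  have hφi : IntegrableOn φ (Ioo 0 1) :=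
    (hφ.continuousOn.integrableOn_Icc (a := 0) (b := 1)).mono_set Ioo_subset_Icc_self
  rw [← MeasureTheory.integral_const_mul,
    ← MeasureTheory.integral_sub (integrable_mul_continuous f hφ) (hφi.const_mul c)]
  refine integral_congr_ae ?_
  filter_upwards [Lp.coeFn_sub f (const c), coeFn_const c] with x h1 h2
  rw [h1, Pi.sub_apply, h2]; ring

/-! ### Translates of test profiles and their periodic-type extension -/

section Translate

variable {ψ : ℝ → ℝ}

theorem memLp_translate (hc : Continuous ψ) (hs : HasCompactSupport ψ) (a : ℝ) :
    MemLp (fun x => ψ (x + a)) 2 unitMeasure :=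
  ((hc.comp (continuous_add_const a)).memLp_of_hasCompactSupport
    (hs.comp_homeomorph (Homeomorph.addRight a))).restrict _

/-- The translate `x ↦ ψ (x + a)` as an element of `L²(0,1)`. -/
noncomputable def translate (hc : Continuous ψ) (hs : HasCompactSupport ψ) (a : ℝ) : L2 :=
  (memLp_translate hc hs a).toLp _

theorem coeFn_translate (hc : Continuous ψ) (hs : HasCompactSupport ψ) (a : ℝ) :
    translate hc hs a =ᵐ[unitMeasure] fun x => ψ (x + a) :=
  (memLp_translate hc hs a).coeFn_toLp

theorem norm_translate_le (hc : Continuous ψ) (hs : HasCompactSupport ψ) (a : ℝ) :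
    ‖translate hc hs a‖ ≤ √(∫ x, ψ x ^ 2) := by
  have hi : Integrable (fun x => ψ (x + a) ^ 2) := by
    have h1 : Integrable (fun x => ψ x * ψ x) :=
      (hc.mul hc).integrable_of_hasCompactSupport (hs.mul_left (f := ψ))
    simpa only [sq] using h1.comp_add_right a
  have h1 : inner ℝ (translate hc hs a) (translate hc hs a) =
      ∫ x in Ioo (0 : ℝ) 1, ψ (x + a) ^ 2 := by
    rw [L2.inner_def]
    refine integral_congr_ae ?_
    filter_upwards [coeFn_translate hc hs a] with x hx
    simp [hx, sq]
  have h2 : ∫ x in Ioo (0 : ℝ) 1, ψ (x + a) ^ 2 ≤ ∫ x, ψ (x + a) ^ 2 :=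
    setIntegral_le_integral hi (ae_of_all _ fun x => sq_nonneg _)
  rw [integral_add_right_eq_self (μ := volume) (fun x => ψ x ^ 2) a] at h2
  rw [norm_eq_sqrt_real_inner, h1]
  exact Real.sqrt_le_sqrt h2

theorem integral_mul_translate_eq_inner (hc : Continuous ψ) (hs : HasCompactSupport ψ) (f : L2)
    (a : ℝ) : ∫ x in Ioo (0 : ℝ) 1, f x * ψ (x + a) =
      inner ℝ f (translate hc hs a) := by
  rw [L2.inner_def]
  refine integral_congr_ae ?_
  filter_upwards [coeFn_translate hc hs a] with x hx
  simp [hx, mul_comm]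

theorem abs_integral_mul_translate_le (hc : Continuous ψ) (hs : HasCompactSupport ψ) (f : L2)
    (a : ℝ) : |∫ x in Ioo (0 : ℝ) 1, f x * ψ (x + a)| ≤ ‖f‖ * √(∫ x, ψ x ^ 2) := by
  rw [integral_mul_translate_eq_inner hc hs]
  exact (abs_real_inner_le_norm _ _).trans
    (mul_le_mul_of_nonneg_left (norm_translate_le hc hs a) (norm_nonneg f))

theorem continuous_translate (hc : ContDiff ℝ 1 ψ) (hs : HasCompactSupport ψ) :
    Continuous (translate hc.continuous hs) := by
  obtain ⟨K, hK⟩ := ContDiff.lipschitzWith_of_hasCompactSupport hs hc one_ne_zero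
  refine (LipschitzWith.of_dist_le_mul (K := K) fun a b => ?_).continuous
  rw [dist_eq_norm, translate, translate, ← MemLp.toLp_sub]
  refine (Lp.norm_le_of_ae_bound (C := K * dist a b) (by positivity) ?_).trans ?_
  · filter_upwards [((memLp_translate hc.continuous hs a).sub
      (memLp_translate hc.continuous hs b)).coeFn_toLp] with x hx
    rw [hx]
    simpa [dist_eq_norm] using hK.dist_le_mul (x + a) (x + b)
  · simp [measureUnivNNReal]

theorem continuous_integral_mul_translate (hc : ContDiff ℝ 1 ψ) (hs : HasCompactSupport ψ)
    {g : ℝ → L2} (hg : Continuous g) {a : ℝ → ℝ} (ha : Continuous a) :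
    Continuous fun t => ∫ x in Ioo (0 : ℝ) 1, g t x * ψ (x + a t) := by
  simp_rw [integral_mul_translate_eq_inner hc.continuous hs]
  exact hg.inner ((continuous_translate hc hs).comp ha)

theorem integral_abs_le (hc : Continuous ψ) (hs : HasCompactSupport ψ)
    (h0 : ∀ y, y ∉ Ioo (0 : ℝ) 1 → ψ y = 0) : ∫ y, |ψ y| ≤ √(∫ y, ψ y ^ 2) := by
  have h := abs_integral_mul_translate_le (ψ := fun y => |ψ y|) hc.abs
    (hs.comp_left (g := fun y => |y|) abs_zero) (const 1) 0
  rw [norm_const_one, one_mul] at h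
  simp only [sq_abs, add_zero] at h
  refine le_trans (le_of_eq ?_) ((le_abs_self _).trans h)
  rw [← setIntegral_eq_integral_of_forall_compl_eq_zero (s := Ioo (0 : ℝ) 1)
    (fun x hx => by rw [h0 x hx, abs_zero])]
  refine integral_congr_ae ?_
  filter_upwards [coeFn_const 1] with x hx
  rw [hx, one_mul]

/-- Substituting u = ξ(t) turns the time integral into one over an interval of distances. The bound
is therefore independent of the time horizon `s` and of the size of the speed. -/
theorem integral_mul_abs_comp_le (hc : Continuous ψ) (hs : HasCompactSupport ψ)
    {ξ v : ℝ → ℝ} (hv : Continuous v) (hξ : ∀ t, HasDerivAt ξ (v t) t) {s : ℝ} (hs0 : 0 ≤ s)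
    (hv0 : ∀ t, 0 ≤ v t) (a : ℝ) :
    ∫ t in (0 : ℝ)..s, v t * |ψ (a - ξ t)| ≤ ∫ y, |ψ y| := by
  have h1 := integral_comp_mul_deriv (a := 0) (b := s) (f := ξ) (f' := v)
    (g := fun u => |ψ (a - u)|) (fun t _ => hξ t) hv.continuousOn (by fun_prop)
  have hmono : Monotone ξ := monotone_of_hasDerivAt_nonneg hξ hv0
  have hi : Integrable fun u => |ψ u| :=
    hc.abs.integrable_of_hasCompactSupport (hs.comp_left (g := fun y => |y|) abs_zero)
  calc _ = ∫ u in ξ 0..ξ s, |ψ (a - u)| := by rw [← h1]; simp [mul_comm]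
    _ = ∫ u in a - ξ s..a - ξ 0, |ψ u| := by
        rw [integral_comp_sub_left (fun u => |ψ u|)]
    _ ≤ ∫ y, |ψ y| := by
        rw [integral_of_le (by linarith [hmono hs0])]
        exact setIntegral_le_integral hi (ae_of_all _ fun x => abs_nonneg _)

/-- The extension of a function `ψ` supported in `(0,1)` by `Ψ (y + 1) = k Ψ y`, up to `y = N`. -/
noncomputable def geometricExtension (k : ℝ) (N : ℕ) (ψ : ℝ → ℝ) (y : ℝ) : ℝ :=
  ∑ n ∈ Finset.range N, k ^ n * ψ (y - n)

theorem contDiff_geometricExtension (k : ℝ) (N : ℕ) (hc : ContDiff ℝ 1 ψ) :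
    ContDiff ℝ 1 (geometricExtension k N ψ) :=
  ContDiff.sum fun _ _ => contDiff_const.mul (hc.comp (contDiff_id.sub contDiff_const))

/-- This supplies the boundary condition φ(t,1) = k φ(t,0). Shifting the index leaves one unmatched
term on each side: the first vanishes because 1 + y ≥ 1, the last because y ≤ N - 1. -/
theorem geometricExtension_one_add (k : ℝ) {N : ℕ} (h0 : ∀ y, y ∉ Ioo (0 : ℝ) 1 → ψ y = 0)
    {y : ℝ} (hy : 0 ≤ y) (hyN : y + 1 ≤ N) :
    geometricExtension k N ψ (1 + y) = k * geometricExtension k N ψ y := by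
  obtain ⟨M, rfl⟩ : ∃ M, N = M + 1 := Nat.exists_eq_succ_of_ne_zero (by
    rintro rfl; norm_num at hyN; linarith)
  push_cast at hyN
  rw [geometricExtension, geometricExtension, Finset.sum_range_succ', Finset.sum_range_succ,
    h0 (y - M) (fun h => by linarith [h.1]), h0 (1 + y - (0 : ℕ)) (fun h => by
      have := h.2; push_cast at this; linarith), mul_zero, mul_zero, add_zero, add_zero,
    Finset.mul_sum]
  refine Finset.sum_congr rfl fun n _ => ?_
  rw [pow_succ']; push_cast
  rw [show 1 + y - (n + 1) = y - n by ring]; ring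

theorem geometricExtension_of_lt_one (k : ℝ) {N : ℕ} (hN : N ≠ 0)
    (h0 : ∀ y, y ∉ Ioo (0 : ℝ) 1 → ψ y = 0) {y : ℝ} (hy : y < 1) :
    geometricExtension k N ψ y = ψ y := by
  obtain ⟨M, rfl⟩ := Nat.exists_eq_succ_of_ne_zero hN
  rw [geometricExtension, Finset.sum_range_succ', Finset.sum_eq_zero, zero_add]
  · simp
  · intro n _
    rw [h0, mul_zero]
    rintro ⟨h, -⟩
    push_cast at h
    linarith [n.cast_nonneg (α := ℝ)]

theorem integral_mul_geometricExtension (k : ℝ) (N : ℕ) (hc : Continuous ψ) (f : L2) (a : ℝ) :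
    ∫ x in Ioo (0 : ℝ) 1, f x * geometricExtension k N ψ (x + a) =
      ∑ n ∈ Finset.range N, k ^ n * ∫ x in Ioo (0 : ℝ) 1, f x * ψ (x + (a - n)) := by
  simp_rw [geometricExtension, Finset.mul_sum]
  rw [MeasureTheory.integral_finsetSum]
  · refine Finset.sum_congr rfl fun n _ => ?_
    rw [← MeasureTheory.integral_const_mul]
    refine integral_congr_ae (ae_of_all _ fun x => ?_)
    simp only [add_sub_assoc]; ring
  · intro n _
    exact integrable_mul_continuous f (φ := fun x => k ^ n * ψ (x + a - n)) (by fun_prop)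

end Translate

/-! ### Characteristics -/

/-- The velocity `λ(W(t))` along `ρ`, frozen at its initial value for negative times. -/
noncomputable def speed (A B : ℝ) (ρ : ℝ → L2) (t : ℝ) : ℝ := velocity A B (mass (ρ (max t 0)))

/-- The distance `∫₀ᵗ λ(W(τ)) dτ` travelled along characteristics. -/
noncomputable def travel (A B : ℝ) (ρ : ℝ → L2) (t : ℝ) : ℝ := ∫ τ in (0 : ℝ)..t, speed A B ρ τ

section Speed

variable {A B : ℝ} {ρ : ℝ → L2}

theorem continuous_extend (hρ : ContinuousOn ρ (Ici 0)) : Continuous fun t => ρ (max t 0) :=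
  hρ.comp_continuous (by fun_prop) fun t => le_max_right t 0

theorem continuous_speed (hB : 0 < B) (hρ : ContinuousOn ρ (Ici 0))
    (hpos : ∀ t : ℝ, 0 ≤ t → IsNonneg (ρ t)) : Continuous (speed A B ρ) := by
  refine continuous_const.div
    (continuous_const.add (continuous_mass.comp (continuous_extend hρ))) fun t => ?_
  have := mass_nonneg (hpos (max t 0) (le_max_right t 0))
  positivity

theorem speed_nonneg (hA : 0 ≤ A) (hB : 0 ≤ B) (hpos : ∀ t : ℝ, 0 ≤ t → IsNonneg (ρ t)) (t : ℝ) :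
    0 ≤ speed A B ρ t := by
  have := mass_nonneg (hpos (max t 0) (le_max_right t 0))
  unfold speed velocity
  positivity

theorem hasDerivAt_travel (hv : Continuous (speed A B ρ)) (t : ℝ) :
    HasDerivAt (travel A B ρ) (speed A B ρ t) t :=
  (hv.integral_hasStrictDerivAt 0 t).hasDerivAt

theorem contDiff_travel (hv : Continuous (speed A B ρ)) : ContDiff ℝ 1 (travel A B ρ) := by
  have : deriv (travel A B ρ) = speed A B ρ := funext fun t => (hasDerivAt_travel hv t).deriv
  rw [contDiff_one_iff_deriv, this]
  exact ⟨fun t => (hasDerivAt_travel hv t).differentiableAt, hv⟩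

theorem travel_zero : travel A B ρ 0 = 0 := integral_same

theorem monotone_travel (hv : Continuous (speed A B ρ)) (h0 : ∀ t, 0 ≤ speed A B ρ t) :
    Monotone (travel A B ρ) :=
  monotone_of_hasDerivAt_nonneg (hasDerivAt_travel hv) h0

end Speed

/-- Moving the window [0,1] by η loses [0,η] and gains [1,1+η], which carries k times the lost
integral. This is the balance for a constant profile, needed to subtract ρ*. -/
theorem integral_eq_integral_shift {Ψ : ℝ → ℝ} {k η : ℝ} (hΨ : Continuous Ψ) (hη : 0 ≤ η)
    (h : ∀ y ∈ Icc 0 η, Ψ (1 + y) = k * Ψ y) :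
    ∫ x in (0 : ℝ)..1, Ψ x =
      (∫ x in (0 : ℝ)..1, Ψ (x + η)) + (1 - k) * ∫ y in (0 : ℝ)..η, Ψ y := by
  have hi : ∀ a b, IntervalIntegrable Ψ volume a b := fun a b => hΨ.intervalIntegrable a b
  have h1 : k * ∫ y in (0 : ℝ)..η, Ψ y = ∫ y in (1 : ℝ)..1 + η, Ψ y := by
    rw [← intervalIntegral.integral_const_mul]
    have := integral_comp_add_left (a := 0) (b := η) Ψ 1
    rw [add_zero] at this
    rw [← this]
    refine integral_congr fun y hy => ?_
    rw [uIcc_of_le hη] at hy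
    exact (h y hy).symm
  have h2 := integral_comp_add_right (a := 0) (b := 1) Ψ η
  rw [sub_mul, one_mul, h1, h2, zero_add]
  have h3 := integral_add_adjacent_intervals (hi 0 η) (hi η (1 + η))
  have h4 := integral_add_adjacent_intervals (hi 0 1) (hi 1 (1 + η))
  linarith

/-! ### Representation of the solution by duality -/

section Duality

variable {A B ρstar k : ℝ} {d : ℝ → ℝ} {ρ₀ : L2} {ρ : ℝ → L2} {ψ : ℝ → ℝ} {N : ℕ} {s : ℝ}

theorem IsDisturbance.intervalIntegrable_mul (hd : IsDisturbance d) {g : ℝ → ℝ} (hg : Continuous g)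
    {s : ℝ} (hs : 0 ≤ s) : IntervalIntegrable (fun t => d t * g t) volume 0 s := by
  obtain ⟨D, hD⟩ := hd.bounded
  rw [intervalIntegrable_iff_integrableOn_Ioc_of_le hs]
  refine Integrable.bdd_mul (c := D) ?_ ?_ ?_
  · exact (hg.integrableOn_Icc (a := 0) (b := s)).mono_set Ioc_subset_Icc_self
  · exact (hd.aemeasurable.mono_measure
      (Measure.restrict_mono (fun t ht => ht.1.le) le_rfl)).aestronglyMeasurable
  · exact (ae_restrict_iff' measurableSet_Ioc).2 (ae_of_all _ fun t ht => hD t ht.1.le)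

/-- Test with χ(t) Ψ(x + ξ(s) - ξ(t)). The transport operator kills the Ψ factor, so only χ' remains
and the weak form says m' = b for the pairing `m`; at time `s` the profile is `ψ` itself on (0,1).
-/
theorem IsWeakSolution.integral_mul_eq (hB : 0 < B) (hA : 0 ≤ A) (hd : IsDisturbance d)
    (hρ : IsWeakSolution A B ρstar k d ρ₀ ρ) (hpos : ∀ t : ℝ, 0 ≤ t → IsNonneg (ρ t))
    (hc : ContDiff ℝ 1 ψ) (hcs : HasCompactSupport ψ)
    (h0 : ∀ y, y ∉ Ioo (0 : ℝ) 1 → ψ y = 0) (hs : 0 < s) (hN : travel A B ρ s + 1 ≤ N) :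
    ∫ x in Ioo (0 : ℝ) 1, ρ s x * ψ x =
      (∫ x in Ioo (0 : ℝ) 1, ρ₀ x * geometricExtension k N ψ (x + travel A B ρ s)) +
      ∫ t in (0 : ℝ)..s, ((1 - k) * ρstar * velocity A B ρstar + k * speed A B ρ t * d t) *
        geometricExtension k N ψ (travel A B ρ s - travel A B ρ t) := by
  set v := speed A B ρ with hv
  set ξ := travel A B ρ with hξ
  set Ψ := geometricExtension k N ψ with hΨ
  have hvc : Continuous v := continuous_speed hB hρ.continuousOn hpos
  have hv0 : ∀ t, 0 ≤ v t := speed_nonneg hA hB.le hpos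
  have hξd : ∀ t, HasDerivAt ξ (v t) t := hasDerivAt_travel hvc
  have hξc : ContDiff ℝ 1 ξ := contDiff_travel hvc
  have hξm : Monotone ξ := monotone_travel hvc hv0
  have hξ0 : ξ 0 = 0 := travel_zero
  have hξs : 0 ≤ ξ s := hξ0 ▸ hξm hs.le
  have hΨc : ContDiff ℝ 1 Ψ := contDiff_geometricExtension k N hc
  have hΨd : ∀ y, HasDerivAt Ψ (deriv Ψ y) y := fun y =>
    (hΨc.differentiable one_ne_zero y).hasDerivAt
  have hN0 : N ≠ 0 := by rintro rfl; norm_num at hN; linarith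
  set m : ℝ → ℝ := fun t => ∫ x in Ioo (0 : ℝ) 1, ρ (max t 0) x * Ψ (x + (ξ s - ξ t)) with hm
  set b : ℝ → ℝ := fun t => ((1 - k) * ρstar * velocity A B ρstar + k * v t * d t) *
    Ψ (ξ s - ξ t) with hb
  have hmc : Continuous m := by
    simp only [hm, hΨ, integral_mul_geometricExtension k N hc.continuous]
    refine continuous_finsetSum _ fun n _ => continuous_const.mul ?_
    refine continuous_integral_mul_translate hc hcs (continuous_extend hρ.continuousOn) ?_
    exact (continuous_const.sub hξc.continuous).sub continuous_const
  have hbi : IntervalIntegrable b volume 0 s := by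
    have i1 : IntervalIntegrable (fun t => (1 - k) * ρstar * velocity A B ρstar * Ψ (ξ s - ξ t))
        volume 0 s := by
      refine Continuous.intervalIntegrable ?_ _ _
      have := hΨc.continuous
      have := hξc.continuous
      fun_prop
    have i2 := hd.intervalIntegrable_mul (g := fun t => k * v t * Ψ (ξ s - ξ t)) (by
      have := hΨc.continuous
      have := hξc.continuous
      fun_prop) hs.le
    refine (i1.add i2).congr ?_
    exact fun t _ => by simp only [hb]; ring
  -- The input is cut off outside (0,s] because `eq_add_integral_of_weak` asks for integrability on
  -- all of ℝ.
  have hind : ∀ t ∈ Ioc 0 s, (Ioc 0 s).indicator b t = b t := fun t ht => indicator_of_mem ht b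
  have key := eq_add_integral_of_weak (m := m) (h := (Ioc 0 s).indicator b)
    (m₀ := ∫ x in Ioo (0 : ℝ) 1, ρ₀ x * Ψ (x + ξ s)) hs hmc
    ((integrable_indicator_iff measurableSet_Ioc).2
      ((intervalIntegrable_iff_integrableOn_Ioc_of_le hs.le).1 hbi)) fun χ hχ hχs => by
    have hχd : ∀ t, HasDerivAt χ (deriv χ t) t := fun t =>
      (hχ.differentiable one_ne_zero t).hasDerivAt
    have hw := hρ.weak s hs (fun t x => χ t * Ψ (x + (ξ s - ξ t)))
      { contDiffOn := by
          refine ContDiff.contDiffOn ?_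
          exact (hχ.comp contDiff_fst).mul (hΨc.comp (contDiff_snd.add
            (contDiff_const.sub (hξc.comp contDiff_fst))))
        final := fun x _ => by simp [hχs]
        boundary := fun t ht => by
          have h1 : ξ t ≤ ξ s := hξm ht.2
          have h2 : 0 ≤ ξ t := hξ0 ▸ hξm ht.1
          rw [hΨ, geometricExtension_one_add k h0 (by linarith) (by linarith), zero_add]
          ring }
    rw [hρ.initial] at hw
    have e1 : ∫ t in (0 : ℝ)..s, deriv χ t * m t =
        ∫ t in Ioo (0 : ℝ) s, ∫ x in Ioo (0 : ℝ) 1,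
          ρ t x * (deriv (fun t' => χ t' * Ψ (x + (ξ s - ξ t'))) t
          + velocity A B (mass (ρ t)) * deriv (fun x' => χ t * Ψ (x' + (ξ s - ξ t))) x) := by
      rw [integral_of_le hs.le, integral_Ioc_eq_integral_Ioo]
      refine setIntegral_congr_fun measurableSet_Ioo fun t ht => ?_
      have hmax : max t 0 = t := max_eq_left ht.1.le
      simp only [hm]
      rw [hmax, ← MeasureTheory.integral_const_mul]
      refine integral_congr_ae (ae_of_all _ fun x => ?_)
      have d1 : HasDerivAt (fun t' => χ t' * Ψ (x + (ξ s - ξ t')))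
          (deriv χ t * Ψ (x + (ξ s - ξ t)) + χ t * (deriv Ψ (x + (ξ s - ξ t)) * (-v t))) t :=
        (hχd t).mul ((hΨd _).comp t (((hξd t).const_sub (ξ s)).const_add x))
      have d2 : HasDerivAt (fun x' => χ t * Ψ (x' + (ξ s - ξ t)))
          (χ t * deriv Ψ (x + (ξ s - ξ t))) x := by
        simpa using ((hΨd _).comp x ((hasDerivAt_id x).add_const (ξ s - ξ t))).const_mul (χ t)
      have hvt : velocity A B (mass (ρ t)) = v t := by rw [hv, speed, hmax]
      simp only
      rw [d1.deriv, d2.deriv, hvt]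
      ring
    have e2 : ∫ t in (0 : ℝ)..s, (Ioc 0 s).indicator b t * χ t =
        ∫ t in Ioo (0 : ℝ) s, ((1 - k) * ρstar * velocity A B ρstar
          + k * velocity A B (mass (ρ t)) * d t) * (χ t * Ψ (0 + (ξ s - ξ t))) := by
      rw [integral_of_le hs.le, integral_Ioc_eq_integral_Ioo]
      refine setIntegral_congr_fun measurableSet_Ioo fun t ht => ?_
      have hvt : velocity A B (mass (ρ t)) = v t := by rw [hv, speed, max_eq_left ht.1.le]
      rw [hind t (Ioo_subset_Ioc_self ht), hvt, zero_add, hb]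
      ring
    have e3 : (∫ x in Ioo (0 : ℝ) 1, ρ₀ x * Ψ (x + ξ s)) * χ 0 =
        ∫ x in Ioo (0 : ℝ) 1, ρ₀ x * (χ 0 * Ψ (x + (ξ s - ξ 0))) := by
      rw [← MeasureTheory.integral_mul_const, hξ0, sub_zero]
      refine integral_congr_ae (ae_of_all _ fun x => ?_)
      simp only; ring
    rw [e1, e2, e3]
    exact hw
  have hms : m s = ∫ x in Ioo (0 : ℝ) 1, ρ s x * ψ x := by
    simp only [hm, max_eq_left hs.le, sub_self, add_zero]
    refine setIntegral_congr_fun measurableSet_Ioo fun x hx => ?_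
    rw [hΨ, geometricExtension_of_lt_one k hN0 h0 hx.2]
  rw [← hms, key]
  congr 1
  rw [integral_of_le hs.le, integral_of_le hs.le]
  exact setIntegral_congr_fun measurableSet_Ioc hind

/-- The constant ρ* satisfies the same formula with input (1-k)ρ*λ(W(t)), by
`integral_eq_integral_shift` and the substitution y = ξ(s) - ξ(t). Subtracting leaves (1-k)ρ*(λ(ρ*)
- λ(W)), which is linear in W - ρ* with factor λ(W). -/
theorem IsWeakSolution.integral_deviation_mul_eq (hB : 0 < B) (hA : 0 ≤ A) (hρs : 0 ≤ ρstar)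
    (hd : IsDisturbance d)
    (hρ : IsWeakSolution A B ρstar k d ρ₀ ρ) (hpos : ∀ t : ℝ, 0 ≤ t → IsNonneg (ρ t))
    (hc : ContDiff ℝ 1 ψ) (hcs : HasCompactSupport ψ)
    (h0 : ∀ y, y ∉ Ioo (0 : ℝ) 1 → ψ y = 0) (hs : 0 < s) (hN : travel A B ρ s + 1 ≤ N) :
    ∫ x in Ioo (0 : ℝ) 1, (ρ s - const ρstar) x * ψ x =
      (∫ x in Ioo (0 : ℝ) 1, (ρ₀ - const ρstar) x *
        geometricExtension k N ψ (x + travel A B ρ s)) +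
      ∫ t in (0 : ℝ)..s, speed A B ρ t *
        ((1 - k) * (ρstar / (B + ρstar)) * mass (ρ (max t 0) - const ρstar) + k * d t) *
        geometricExtension k N ψ (travel A B ρ s - travel A B ρ t) := by
  have hvc : Continuous (speed A B ρ) := continuous_speed hB hρ.continuousOn hpos
  have hv0 : ∀ t, 0 ≤ speed A B ρ t := speed_nonneg hA hB.le hpos
  have hξd := hasDerivAt_travel hvc
  have hξc := (contDiff_travel hvc).continuous
  have hξs : 0 ≤ travel A B ρ s := travel_zero (A := A) (B := B) (ρ := ρ) ▸
    monotone_travel hvc hv0 hs.le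
  have hN0 : N ≠ 0 := by rintro rfl; norm_num at hN; linarith
  have hΨc := (contDiff_geometricExtension k N hc).continuous
  rw [integral_sub_const_mul _ _ hc.continuous,
    integral_sub_const_mul ρ₀ ρstar
      (φ := fun x => geometricExtension k N ψ (x + travel A B ρ s)) (by fun_prop),
    hρ.integral_mul_eq hB hA hd hpos hc hcs h0 hs hN]
  have hshift := integral_eq_integral_shift (k := k) hΨc hξs (fun y hy =>
    geometricExtension_one_add k (N := N) h0 hy.1 (by linarith [hy.2]))
  rw [integral_of_le zero_le_one, integral_of_le zero_le_one, integral_Ioc_eq_integral_Ioo,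
    integral_Ioc_eq_integral_Ioo, setIntegral_congr_fun (g := ψ) measurableSet_Ioo
      (fun x hx => geometricExtension_of_lt_one k hN0 h0 hx.2)] at hshift
  have hsub : ∫ y in (0 : ℝ)..travel A B ρ s, geometricExtension k N ψ y =
      ∫ t in (0 : ℝ)..s, speed A B ρ t *
        geometricExtension k N ψ (travel A B ρ s - travel A B ρ t) := by
    have h1 := integral_comp_mul_deriv (a := 0) (b := s) (f := travel A B ρ) (f' := speed A B ρ)
      (g := fun u => geometricExtension k N ψ (travel A B ρ s - u)) (fun t _ => hξd t)
      hvc.continuousOn (by fun_prop)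
    rw [integral_comp_sub_left (fun u => geometricExtension k N ψ u), sub_self, travel_zero,
      sub_zero] at h1
    rw [← h1]
    exact integral_congr fun t _ => mul_comm _ _
  have hlin : ∫ t in (0 : ℝ)..s, speed A B ρ t *
        ((1 - k) * (ρstar / (B + ρstar)) * mass (ρ (max t 0) - const ρstar) + k * d t) *
        geometricExtension k N ψ (travel A B ρ s - travel A B ρ t) =
      (∫ t in (0 : ℝ)..s, ((1 - k) * ρstar * velocity A B ρstar + k * speed A B ρ t * d t) *
        geometricExtension k N ψ (travel A B ρ s - travel A B ρ t)) -
      ρstar * (1 - k) * ∫ t in (0 : ℝ)..s, speed A B ρ t *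
        geometricExtension k N ψ (travel A B ρ s - travel A B ρ t) := by
    rw [← intervalIntegral.integral_const_mul, ← intervalIntegral.integral_sub]
    · refine integral_congr fun t _ => ?_
      have hW := mass_nonneg (hpos (max t 0) (le_max_right t 0))
      have h1 : velocity A B ρstar - speed A B ρ t =
          speed A B ρ t * mass (ρ (max t 0) - const ρstar) / (B + ρstar) := by
        rw [mass_sub, mass_const, speed, velocity, velocity]
        field_simp
        ring
      have h2 : velocity A B ρstar = speed A B ρ t +
          speed A B ρ t * mass (ρ (max t 0) - const ρstar) / (B + ρstar) := by linarith
      rw [h2]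
      ring
    · have i2 := hd.intervalIntegrable_mul (g := fun t => k * speed A B ρ t *
        geometricExtension k N ψ (travel A B ρ s - travel A B ρ t)) (by fun_prop) hs.le
      have i1 : IntervalIntegrable (fun t => (1 - k) * ρstar * velocity A B ρstar *
          geometricExtension k N ψ (travel A B ρ s - travel A B ρ t)) volume 0 s :=
        Continuous.intervalIntegrable (by fun_prop) _ _
      exact (i1.add i2).congr fun t _ => by ring
    · exact Continuous.intervalIntegrable (by fun_prop) _ _
  rw [hlin, ← hsub, hshift]
  ring

end Duality

/-! ### Estimates weighted by the distance travelled -/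

theorem geom_sum_le_inv {r : ℝ} (h0 : 0 ≤ r) (h1 : r < 1) (N : ℕ) :
    ∑ n ∈ Finset.range N, r ^ n ≤ (1 - r)⁻¹ := by
  rw [← tsum_geometric_of_lt_one h0 h1]
  exact (summable_geometric_of_lt_one h0 h1).sum_le_tsum _ fun n _ => pow_nonneg h0 n

/-- The n-th copy of `ψ` meets the window only if n > η - 1, and then 1 ≤ eᶜⁿ eᶜ e^(-cη). Inserting
this factor trades the k^n of the surviving terms for (k eᶜ)^n times the decay. -/
theorem abs_integral_mul_geometricExtension_le {k c η : ℝ} {N : ℕ} {ψ : ℝ → ℝ} (hk : 0 ≤ k)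
    (hc0 : 0 ≤ c) (hkc : k * Real.exp c < 1) (hc : Continuous ψ) (hcs : HasCompactSupport ψ)
    (h0 : ∀ y, y ∉ Ioo (0 : ℝ) 1 → ψ y = 0) (f : L2) :
    |∫ x in Ioo (0 : ℝ) 1, f x * geometricExtension k N ψ (x + η)| ≤
      Real.exp c / (1 - k * Real.exp c) * Real.exp (-(c * η)) * ‖f‖ * √(∫ x, ψ x ^ 2) := by
  set E := Real.exp c with hE
  have hE0 : 0 < E := Real.exp_pos c
  set Q := √(∫ x, ψ x ^ 2) with hQ
  rw [integral_mul_geometricExtension k N hc]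
  have hterm : ∀ n ∈ Finset.range N,
      |k ^ n * ∫ x in Ioo (0 : ℝ) 1, f x * ψ (x + (η - n))| ≤
        (k * E) ^ n * (E * Real.exp (-(c * η)) * ‖f‖ * Q) := by
    intro n _
    rcases le_or_gt (n : ℝ) (η - 1) with hn | hn
    · rw [setIntegral_eq_zero_of_forall_eq_zero fun x hx => by
        rw [h0 _ (fun h => by linarith [h.2, hx.1]), mul_zero]]
      rw [mul_zero, abs_zero]
      positivity
    · rw [abs_mul, abs_of_nonneg (pow_nonneg hk n)]
      have h1 := abs_integral_mul_translate_le hc hcs f (η - n)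
      have h2 : 1 ≤ E ^ n * (E * Real.exp (-(c * η))) := by
        rw [hE, ← Real.exp_nat_mul, ← Real.exp_add, ← Real.exp_add]
        refine Real.one_le_exp ?_
        nlinarith
      calc _ ≤ k ^ n * (‖f‖ * Q) := by gcongr
        _ ≤ k ^ n * (‖f‖ * Q) * (E ^ n * (E * Real.exp (-(c * η)))) :=
            le_mul_of_one_le_right (by positivity) h2
        _ = _ := by rw [mul_pow]; ring
  calc _ ≤ ∑ n ∈ Finset.range N, |k ^ n * ∫ x in Ioo (0 : ℝ) 1, f x * ψ (x + (η - n))| :=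
        Finset.abs_sum_le_sum_abs _ _
    _ ≤ ∑ n ∈ Finset.range N, (k * E) ^ n * (E * Real.exp (-(c * η)) * ‖f‖ * Q) :=
        Finset.sum_le_sum hterm
    _ ≤ (1 - k * E)⁻¹ * (E * Real.exp (-(c * η)) * ‖f‖ * Q) := by
        rw [← Finset.sum_mul]
        exact mul_le_mul_of_nonneg_right (geom_sum_le_inv (by positivity) hkc N) (by positivity)
    _ = _ := by rw [div_eq_mul_inv]; ring

/-- On the support of the n-th copy ξ(t) > ξ(s) - n - 1, so e^(-cξ(t)) ≤ eᶜ⁽ⁿ⁺¹⁾ e^(-cξ(s)). The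
constant part of the input is then summed against k^n and the decaying part against (k eᶜ)^n, each
copy costing at most one integral of |ψ|. -/
theorem abs_integral_input_le {k c a b s : ℝ} {N : ℕ} {ψ ξ v g : ℝ → ℝ} (hk : 0 ≤ k) (hk1 : k < 1)
    (hc0 : 0 ≤ c) (hkc : k * Real.exp c < 1) (hc : Continuous ψ) (hcs : HasCompactSupport ψ)
    (h0 : ∀ y, y ∉ Ioo (0 : ℝ) 1 → ψ y = 0) (hv : Continuous v)
    (hξ : ∀ t, HasDerivAt ξ (v t) t) (hv0 : ∀ t, 0 ≤ v t) (hs : 0 ≤ s) (ha : 0 ≤ a) (hb : 0 ≤ b)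
    (hg : ∀ t ∈ Icc 0 s, |g t| ≤ a + b * Real.exp (-(c * ξ t))) :
    |∫ t in (0 : ℝ)..s, v t * g t * geometricExtension k N ψ (ξ s - ξ t)| ≤
      (a / (1 - k) + b * (Real.exp c / (1 - k * Real.exp c)) * Real.exp (-(c * ξ s))) *
        √(∫ x, ψ x ^ 2) := by
  set E := Real.exp c with hE
  have hE0 : 0 < E := Real.exp_pos c
  set Q := √(∫ x, ψ x ^ 2) with hQ
  set ε := Real.exp (-(c * ξ s)) with hε
  have hξc : Continuous ξ := continuous_iff_continuousAt.2 fun t => (hξ t).continuousAt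
  set w : ℕ → ℝ := fun n => k ^ n * a + (k * E) ^ n * (b * E * ε) with hw
  have hw0 : ∀ n, 0 ≤ w n := fun n => by positivity
  have hpt : ∀ t ∈ Ioc 0 s, ‖v t * g t * geometricExtension k N ψ (ξ s - ξ t)‖ ≤
      ∑ n ∈ Finset.range N, w n * (v t * |ψ (ξ s - n - ξ t)|) := by
    intro t ht
    rw [geometricExtension, Finset.mul_sum]
    refine (norm_sum_le _ _).trans (Finset.sum_le_sum fun n _ => ?_)
    rw [sub_right_comm, Real.norm_eq_abs, abs_mul, abs_mul, abs_mul, abs_of_nonneg (hv0 t),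
      abs_of_nonneg (pow_nonneg hk n)]
    by_cases hy : ξ s - n - ξ t ∈ Ioo (0 : ℝ) 1
    · have h1 : Real.exp (-(c * ξ t)) ≤ E ^ n * E * ε := by
        rw [hE, hε, ← Real.exp_nat_mul, ← Real.exp_add, ← Real.exp_add, Real.exp_le_exp]
        nlinarith [hy.2]
      calc v t * |g t| * (k ^ n * |ψ (ξ s - n - ξ t)|)
          ≤ v t * (a + b * (E ^ n * E * ε)) * (k ^ n * |ψ (ξ s - n - ξ t)|) := by
            gcongr
            · exact hv0 t
            · exact (hg t ⟨ht.1.le, ht.2⟩).trans (by gcongr)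
        _ = _ := by simp only [hw, mul_pow]; ring
    · rw [h0 _ hy]; simp
  have hint : ∀ n : ℕ, IntervalIntegrable (fun t => w n * (v t * |ψ (ξ s - n - ξ t)|))
      volume 0 s := fun n => Continuous.intervalIntegrable (by fun_prop) _ _
  calc _ ≤ ∫ t in (0 : ℝ)..s, ∑ n ∈ Finset.range N, w n * (v t * |ψ (ξ s - n - ξ t)|) :=
        norm_integral_le_of_norm_le hs (ae_of_all _ hpt)
          (Continuous.intervalIntegrable (by fun_prop) _ _)
    _ = ∑ n ∈ Finset.range N, w n * ∫ t in (0 : ℝ)..s, v t * |ψ (ξ s - n - ξ t)| := by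
        rw [intervalIntegral.integral_finsetSum fun n _ => hint n]
        simp_rw [intervalIntegral.integral_const_mul]
    _ ≤ ∑ n ∈ Finset.range N, w n * Q := Finset.sum_le_sum fun n _ =>
        mul_le_mul_of_nonneg_left ((integral_mul_abs_comp_le hc hcs hv hξ hs hv0 _).trans
          (integral_abs_le hc hcs h0)) (hw0 n)
    _ = ((∑ n ∈ Finset.range N, k ^ n) * a +
          (∑ n ∈ Finset.range N, (k * E) ^ n) * (b * E * ε)) * Q := by
        rw [← Finset.sum_mul]
        simp only [hw, Finset.sum_add_distrib, Finset.sum_mul]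
    _ ≤ ((1 - k)⁻¹ * a + (1 - k * E)⁻¹ * (b * E * ε)) * Q := by
        have := geom_sum_le_inv hk hk1 N
        have := geom_sum_le_inv (by positivity) hkc N
        gcongr
    _ = _ := by rw [div_eq_mul_inv, div_eq_mul_inv]; ring

/-! ### Small-gain argument -/

section Stability

variable {A B ρstar k : ℝ} {d : ℝ → ℝ} {ρ₀ : L2} {ρ : ℝ → L2}

/-- One step of the small-gain argument: an a priori bound on `[0,s]` improves itself at time `s`. -/
theorem IsWeakSolution.norm_deviation_le {c a b D s : ℝ} (hB : 0 < B) (hA : 0 ≤ A)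
    (hρs : 0 ≤ ρstar) (hk : 0 ≤ k) (hk1 : k < 1) (hd : IsDisturbance d)
    (hρ : IsWeakSolution A B ρstar k d ρ₀ ρ) (hpos : ∀ t : ℝ, 0 ≤ t → IsNonneg (ρ t))
    (hc0 : 0 ≤ c) (hkc : k * Real.exp c < 1) (hs : 0 < s) (ha : 0 ≤ a) (hb : 0 ≤ b) (hD0 : 0 ≤ D)
    (hD : ∀ t ∈ Icc 0 s, |d t| ≤ D)
    (hf : ∀ t ∈ Icc 0 s, ‖ρ t - const ρstar‖ ≤ a + b * Real.exp (-(c * travel A B ρ t))) :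
    ‖ρ s - const ρstar‖ ≤
      ((1 - k) * (ρstar / (B + ρstar)) * a + k * D) / (1 - k) +
      (‖ρ₀ - const ρstar‖ + (1 - k) * (ρstar / (B + ρstar)) * b) *
        (Real.exp c / (1 - k * Real.exp c)) * Real.exp (-(c * travel A B ρ s)) := by
  have hvc : Continuous (speed A B ρ) := continuous_speed hB hρ.continuousOn hpos
  have hv0 : ∀ t, 0 ≤ speed A B ρ t := speed_nonneg hA hB.le hpos
  have hk' : 0 < 1 - k := by linarith
  have hkc' : 0 < 1 - k * Real.exp c := by linarith
  set θ := ρstar / (B + ρstar) with hθ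
  have hθ0 : 0 ≤ θ := by positivity
  refine norm_le_of_forall_smooth _ (by positivity) fun ψ hψ hcs hsupp => ?_
  have hψ1 : ContDiff ℝ 1 ψ := hψ.of_le (by exact_mod_cast le_top)
  have h0 : ∀ y, y ∉ Ioo (0 : ℝ) 1 → ψ y = 0 := fun y hy =>
    image_eq_zero_of_notMem_tsupport fun h => hy (hsupp h)
  -- Any such `N` will do, since the two estimates below are uniform in the truncation.
  obtain ⟨N, hN⟩ := exists_nat_ge (travel A B ρ s + 1)
  rw [hρ.integral_deviation_mul_eq hB hA hρs hd hpos hψ1 hcs h0 hs hN]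
  have h1 := abs_integral_mul_geometricExtension_le (N := N) (η := travel A B ρ s) hk hc0 hkc
    hψ.continuous hcs h0 (ρ₀ - const ρstar)
  have h2 := abs_integral_input_le (N := N) (s := s) (a := (1 - k) * θ * a + k * D)
    (b := (1 - k) * θ * b)
    (g := fun t => (1 - k) * θ * mass (ρ (max t 0) - const ρstar) + k * d t)
    hk hk1 hc0 hkc hψ.continuous hcs h0 hvc (hasDerivAt_travel hvc) hv0 hs.le (by positivity)
    (by positivity) (fun t ht => by
      rw [max_eq_left ht.1]
      have e1 := (abs_mass_le _).trans (hf t ht)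
      have e2 := hD t ht
      calc _ ≤ |(1 - k) * θ * mass (ρ t - const ρstar)| + |k * d t| := abs_add_le _ _
        _ = (1 - k) * θ * |mass (ρ t - const ρstar)| + k * |d t| := by
            rw [abs_mul, abs_mul k, abs_of_nonneg hk, abs_of_nonneg (by positivity)]
        _ ≤ (1 - k) * θ * (a + b * Real.exp (-(c * travel A B ρ t))) + k * D := by gcongr
        _ = _ := by ring)
  refine (abs_add_le _ _).trans ((add_le_add h1 h2).trans (le_of_eq ?_))
  ring

/-- The one-step bound is applied where the weighted excess `G` over the level M D is maximal. It
returns that maximum with a factor which the gain condition makes less than one, so it can be solved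
for. -/
theorem IsWeakSolution.norm_deviation_le_travel {c D T : ℝ} (hB : 0 < B) (hA : 0 ≤ A)
    (hρs : 0 ≤ ρstar) (hk : 0 ≤ k) (hk1 : k < 1) (hd : IsDisturbance d)
    (hρ : IsWeakSolution A B ρstar k d ρ₀ ρ) (hpos : ∀ t : ℝ, 0 ≤ t → IsNonneg (ρ t))
    (hc0 : 0 ≤ c)
    (hgain : ((1 - k) * (ρstar / (B + ρstar)) + k) * Real.exp c < 1) (hD0 : 0 ≤ D)
    (hD : ∀ t ∈ Icc 0 T, |d t| ≤ D) {t : ℝ} (ht : t ∈ Icc 0 T) :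
    ‖ρ t - const ρstar‖ ≤
      Real.exp c / (1 - ((1 - k) * (ρstar / (B + ρstar)) + k) * Real.exp c) *
        Real.exp (-(c * travel A B ρ t)) * ‖ρ₀ - const ρstar‖ +
      k / ((1 - k) * (1 - ρstar / (B + ρstar))) * D := by
  have hvc : Continuous (speed A B ρ) := continuous_speed hB hρ.continuousOn hpos
  have hξc := (contDiff_travel hvc).continuous
  have hk' : 0 < 1 - k := by linarith
  have hθ1 : 0 < 1 - ρstar / (B + ρstar) := by
    rw [sub_pos, div_lt_one (by positivity)]; linarith
  have hθ0 : 0 ≤ ρstar / (B + ρstar) := by positivity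
  set θ := ρstar / (B + ρstar) with hθ
  set E := Real.exp c with hE
  have hE1 : 1 ≤ E := Real.one_le_exp hc0
  have hgain' : 0 < 1 - ((1 - k) * θ + k) * E := by linarith
  have hkE : 0 < 1 - k * E := by nlinarith [mul_nonneg (mul_nonneg hk'.le hθ0) (by linarith : 0 ≤ E)]
  -- M D is the fixed point of a ↦ ((1-k)θ a + k D)/(1-k), so the one-step bound reproduces this
  -- constant part exactly.
  set M := k / ((1 - k) * (1 - θ)) with hM
  have hM0 : 0 ≤ M := by positivity
  set F := ‖ρ₀ - const ρstar‖ with hF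
  set G : ℝ → ℝ := fun τ => Real.exp (c * travel A B ρ τ) * (‖ρ τ - const ρstar‖ - M * D) with hG
  have hexp : ∀ τ, Real.exp (c * travel A B ρ τ) * Real.exp (-(c * travel A B ρ τ)) = 1 := by
    intro τ; rw [← Real.exp_add, add_neg_cancel, Real.exp_zero]
  have hGle : ∀ τ b : ℝ, G τ ≤ b →
      ‖ρ τ - const ρstar‖ ≤ M * D + b * Real.exp (-(c * travel A B ρ τ)) := by
    intro τ b h
    have h1 := mul_le_mul_of_nonneg_right h (Real.exp_pos (-(c * travel A B ρ τ))).le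
    have h2 : G τ * Real.exp (-(c * travel A B ρ τ)) = ‖ρ τ - const ρstar‖ - M * D := by
      simp only [hG]
      linear_combination (‖ρ τ - const ρstar‖ - M * D) * hexp τ
    linarith
  have hGc : ContinuousOn G (Icc 0 T) := by
    have := hρ.continuousOn.mono (Icc_subset_Ici_self : Icc 0 T ⊆ Ici 0)
    have h2 : ContinuousOn (fun τ => Real.exp (c * travel A B ρ τ)) (Icc 0 T) := by fun_prop
    exact h2.mul ((this.sub continuousOn_const).norm.sub continuousOn_const)
  obtain ⟨τ, hτ, hmax⟩ := isCompact_Icc.exists_isMaxOn ⟨t, ht⟩ hGc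
  have hbound : G τ ≤ E / (1 - ((1 - k) * θ + k) * E) * F := by
    rcases le_or_gt (G τ) 0 with hneg | hGpos
    · exact hneg.trans (by positivity)
    have hstep : G τ ≤ (F + (1 - k) * θ * G τ) * (E / (1 - k * E)) := by
      -- The one-step bound needs a positive time, so a maximum at time zero is compared with the
      -- initial datum directly.
      rcases hτ.1.eq_or_lt with h00 | hτ0
      · have hle : G τ ≤ F := by
          simp only [hG, hF]
          rw [← h00, travel_zero, hρ.initial, mul_zero, Real.exp_zero, one_mul]
          linarith [mul_nonneg hM0 hD0]
        have h1 : 1 ≤ E / (1 - k * E) := by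
          rw [le_div_iff₀ hkE]; nlinarith
        have h2 : 0 ≤ (1 - k) * θ * G τ := by positivity
        calc G τ ≤ F + (1 - k) * θ * G τ := by linarith
          _ ≤ _ := le_mul_of_one_le_right (by positivity) h1
      · have h1 := hρ.norm_deviation_le (a := M * D) (b := G τ) (c := c) hB hA hρs hk hk1 hd hpos
          hc0 (by linarith) hτ0 (by positivity) hGpos.le hD0
          (fun r hr => hD r ⟨hr.1, hr.2.trans hτ.2⟩)
          (fun r hr => hGle r _ (hmax ⟨hr.1, hr.2.trans hτ.2⟩))
        have h2 : ((1 - k) * θ * (M * D) + k * D) / (1 - k) = M * D := by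
          rw [hM]; field_simp; ring
        rw [← hθ, h2] at h1
        have h3 := mul_le_mul_of_nonneg_left (sub_le_iff_le_add'.2 h1)
          (Real.exp_pos (c * travel A B ρ τ)).le
        refine h3.trans (le_of_eq ?_)
        linear_combination (F + (1 - k) * θ * G τ) * (E / (1 - k * E)) * hexp τ
    rw [← mul_div_assoc, le_div_iff₀ hkE] at hstep
    rw [div_mul_eq_mul_div, le_div_iff₀ hgain']
    linarith
  have := hGle t _ ((hmax ht).trans hbound)
  linarith

end Stability

end NonlocalTransport

/-! ### From distance travelled to time -/

theorem theorem2p3 (A B ρstar k R : ℝ) (hA : 0 < A) (hB : 0 < B) (hρstar : 0 ≤ ρstar)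
    (hk0 : 0 ≤ k) (hk1 : k < 1) (hR : 0 < R) :
    ∃ γ₁ γ₂ γ₃ : ℝ, 0 < γ₁ ∧ 0 < γ₂ ∧ 0 < γ₃ ∧
      ∀ d : ℝ → ℝ, NonlocalTransport.IsDisturbance d →
      ∀ ρ₀ : NonlocalTransport.L2, NonlocalTransport.IsNonneg ρ₀ →
        ‖ρ₀ - NonlocalTransport.const ρstar‖ ≤ R →
      ∀ ρ : ℝ → NonlocalTransport.L2,
        NonlocalTransport.IsWeakSolution A B ρstar k d ρ₀ ρ →
        (∀ t : ℝ, 0 ≤ t → NonlocalTransport.IsNonneg (ρ t)) →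
      ∀ t : ℝ, 0 ≤ t →
        ‖ρ t - NonlocalTransport.const ρstar‖ ≤
          γ₂ * Real.exp (-γ₁ * t) * ‖ρ₀ - NonlocalTransport.const ρstar‖
            + γ₃ * sSup ((fun s => |d s|) '' Set.Icc 0 t) := by
  open NonlocalTransport in
  have hθ1 : ρstar / (B + ρstar) < 1 := by rw [div_lt_one (by positivity)]; linarith
  have hθ0 : 0 ≤ ρstar / (B + ρstar) := by positivity
  set θ := ρstar / (B + ρstar) with hθ
  set q := (1 - k) * θ + k with hq
  have hk' : 0 < 1 - k := by linarith
  have hθ' : 0 < 1 - θ := by linarith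
  have hq0 : 0 ≤ q := by positivity
  have hq1 : q < 1 := by nlinarith
  obtain ⟨c, hc0, hqc⟩ : ∃ c : ℝ, 0 < c ∧ q * Real.exp c < 1 := by
    -- Here eᶜ = 2/(1+q), which exceeds 1 and has q eᶜ < 1, both because q < 1.
    refine ⟨Real.log (2 / (1 + q)), Real.log_pos ?_, ?_⟩
    · rw [lt_div_iff₀ (by positivity)]; linarith
    · rw [Real.exp_log (by positivity), ← mul_div_assoc, div_lt_one (by positivity)]; linarith
  set K := Real.exp c / (1 - q * Real.exp c) with hK
  have hK0 : 0 < K := div_pos (Real.exp_pos c) (by linarith)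
  set M := k / ((1 - k) * (1 - θ)) with hM
  have hM0 : 0 ≤ M := by positivity
  -- The speed at the largest mass allowed by the coarse bound when D ≤ 1; only here and in the gain
  -- on `d` does `R` enter.
  set vmin := A / (B + (ρstar + K * R + M)) with hvmin
  have hvmin0 : 0 < vmin := by positivity
  refine ⟨c * vmin, K, K * R + M + 1, by positivity, hK0, by positivity, ?_⟩
  intro d hd ρ₀ _ hρ₀ ρ hρ hpos t ht
  have hvc : Continuous (speed A B ρ) := continuous_speed hB hρ.continuousOn hpos
  have hv0 : ∀ t, 0 ≤ speed A B ρ t := speed_nonneg hA.le hB.le hpos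
  set D := sSup ((fun s => |d s|) '' Set.Icc 0 t) with hDdef
  have hD : ∀ s ∈ Set.Icc 0 t, |d s| ≤ D := by
    obtain ⟨C, hC⟩ := hd.bounded
    intro s hs
    refine le_csSup ⟨C, ?_⟩ ⟨s, hs, rfl⟩
    rintro _ ⟨r, hr, rfl⟩
    exact hC r hr.1
  have hD0 : 0 ≤ D := (abs_nonneg (d 0)).trans (hD 0 ⟨le_rfl, ht⟩)
  have hmain : ∀ s ∈ Set.Icc 0 t, ‖ρ s - const ρstar‖ ≤
      K * Real.exp (-(c * travel A B ρ s)) * ‖ρ₀ - const ρstar‖ + M * D := fun s hs =>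
    hρ.norm_deviation_le_travel hB hA.le hρstar hk0 hk1 hd hpos hc0.le hqc hD0 hD hs
  have htravel : ∀ s, 0 ≤ s → 0 ≤ travel A B ρ s := fun s hs =>
    travel_zero (A := A) (B := B) (ρ := ρ) ▸ monotone_travel hvc hv0 hs
  have hcoarse : ∀ s ∈ Set.Icc 0 t, ‖ρ s - const ρstar‖ ≤ K * R + M * D := fun s hs => by
    refine (hmain s hs).trans ?_
    have h1 : Real.exp (-(c * travel A B ρ s)) ≤ 1 :=
      Real.exp_le_one_iff.2 (neg_nonpos.2 (mul_nonneg hc0.le (htravel s hs.1)))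
    have h2 : K * Real.exp (-(c * travel A B ρ s)) * ‖ρ₀ - const ρstar‖ ≤ K * 1 * R := by gcongr
    linarith
  rcases le_or_gt D 1 with hD1 | hD1
  · have hspeed : ∀ s ∈ Set.Icc 0 t, vmin ≤ speed A B ρ s := fun s hs => by
      rw [speed, max_eq_left hs.1, velocity, hvmin]
      have h1 := (le_abs_self _).trans ((abs_mass_le _).trans (hcoarse s hs))
      rw [mass_sub, mass_const] at h1
      have h2 := mass_nonneg (hpos s hs.1)
      have h3 : M * D ≤ M := mul_le_of_le_one_right hM0 hD1
      gcongr
      linarith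
    have hlow : vmin * t ≤ travel A B ρ t := by
      have h1 : ∫ _ in (0 : ℝ)..t, vmin ≤ travel A B ρ t :=
        intervalIntegral.integral_mono_on ht intervalIntegrable_const
          (hvc.intervalIntegrable _ _) hspeed
      rw [intervalIntegral.integral_const, smul_eq_mul] at h1
      linarith
    refine (hmain t ⟨ht, le_rfl⟩).trans ?_
    have h1 : Real.exp (-(c * travel A B ρ t)) ≤ Real.exp (-(c * vmin) * t) := by
      rw [Real.exp_le_exp]
      nlinarith
    have h2 : M * D ≤ (K * R + M + 1) * D := by
      gcongr
      linarith [mul_pos hK0 hR]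
    gcongr
  -- For D > 1 no decay is needed: K R ≤ K R D goes into the disturbance term.
  · have h1 := hcoarse t ⟨ht, le_rfl⟩
    have h2 : 0 ≤ K * Real.exp (-(c * vmin) * t) * ‖ρ₀ - const ρstar‖ := by positivity
    have h3 : K * R ≤ K * R * D := le_mul_of_one_le_right (by positivity) hD1.le
    nlinarith
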